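/- Let $k$ be a commutative ring and let $X$ be a finite set. Relations on $X$ (subsets of $X\times X$) form a monoid under $RS=\{(x,z)\mid \exists y:\ (x,y)\in R,\ (y,z)\in S\}$; let $\mathcal R$ be its monoid algebra over $k$. Write $\Sigma$ for the symmetric group on $X$ and, for $\sigma\in\Sigma$, put $\Delta_\sigma=\{(\sigma(x),x)\mid x\in X\}$, $\Delta=\Delta_{\mathrm{id}}$, and ${}^\sigma R=\Delta_\sigma R\Delta_{\sigma^{-1}}$. A relation on $X$ is inessential if it is a composite $ST$ with $S\subseteq X\times Y$ and $T\subseteq Y\times X$ for some set $Y$ with $|Y|<|X|$, and essential otherwise. Let $I$ be the two-sided ideal of $\mathcal R$ spanned over $k$ by the inessential relations and let $\mathcal E=\mathcal R/I$. Let $N$ be the two-sided ideal of $\mathcal E$ spanned over $k$ by the elements $(S-\overline S)\Delta_\sigma$, where $S$ runs over the reflexive essential relations on $X$, $\overline S$ is the transitive closure of $S$, and $\sigma\in\Sigma$. Let $\mathcal P=\mathcal E/N$. Relations act on left $\mathcal P$-modules through the quotient maps $\mathcal R\to\mathcal E\to\mathcal P$. Let $\mathcal O$ be the set of all (partial) orders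 on $X$, ordered by containment, with Möbius function $\mu$, and for $R\in\mathcal O$ let $$f_R=\sum_{S\in\mathcal O,\ R\subseteq S}\mu(R,S)\,S\ \in\ \mathcal P .$$ Let $R$ be an order on $X$. Then the elements $\Delta_\sigma f_R$ ($\sigma\in\Sigma$) form a $k$-basis of the left ideal $\mathcal P f_R$ and, for every relation $Q$ on $X$ and every $\sigma\in\Sigma$, $$Q\cdot\Delta_\sigma f_R=\begin{cases}\Delta_{\tau\sigma}f_R & \text{if there is } \tau\in\Sigma \text{ such that } \Delta\subseteq\Delta_{\tau^{-1}}Q\subseteq{}^\sigma R,\\ 0 & \text{otherwise.}\end{cases}$$ -/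

import Mathlib

universe u v

namespace PermutedOrders

section Relations

variable {X : Type u}

/-- Relations on `X` (subsets of `X × X`) form a monoid under the composition
`RS = {(x, z) | ∃ y, (x, y) ∈ R and (y, z) ∈ S}`, with the diagonal as identity. -/
instance relMonoid : Monoid (SetRel X X) where
  mul R S := R.comp S
  one := SetRel.id
  mul_assoc R S T := SetRel.comp_assoc R S T
  one_mul R := SetRel.id_comp R
  mul_one R := SetRel.comp_id R

theorem mem_mul_iff {R S : SetRel X X} {x z : X} :
    (x, z) ∈ R * S ↔ ∃ y, (x, y) ∈ R ∧ (y, z) ∈ S := Iff.rfl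

theorem mem_one_iff {x y : X} : (x, y) ∈ (1 : SetRel X X) ↔ x = y := Iff.rfl

/-- A relation on `X` is inessential if it factorizes through a set `Y` with fewer elements
than `X`. -/
def Inessential (R : SetRel X X) : Prop :=
  ∃ (Y : Type u) (_ : Finite Y) (S : SetRel X Y) (T : SetRel Y X),
    Nat.card Y < Nat.card X ∧ R = S.comp T

/-- A relation is essential if it is not inessential. -/
def Essential (R : SetRel X X) : Prop := ¬ Inessential R

/-- The relation `Δ_σ = {(σ(x), x) | x ∈ X}`. In particular `Δ = Δ_id` is the diagonal. -/
def permRel (σ : Equiv.Perm X) : SetRel X X := Set.range fun x => (σ x, x)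

/-- The conjugate `Δ_σ R Δ_{σ⁻¹}` of a relation. -/
def conjRel (σ : Equiv.Perm X) (R : SetRel X X) : SetRel X X := permRel σ * R * permRel σ⁻¹

/-- The transitive closure of a relation. -/
def transClosure (R : SetRel X X) : SetRel X X :=
  {p | Relation.TransGen (fun x y => (x, y) ∈ R) p.1 p.2}

/-- A relation is reflexive if it contains the diagonal. -/
def IsReflexive (R : SetRel X X) : Prop := ∀ x, (x, x) ∈ R

/-- An order is a partial order relation. -/
structure IsOrder (R : SetRel X X) : Prop where
  refl : IsReflexive R
  antisymm : ∀ x y, (x, y) ∈ R → (y, x) ∈ R → x = y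
  trans : ∀ x y z, (x, y) ∈ R → (y, z) ∈ R → (x, z) ∈ R

theorem mem_perm_iff {σ : Equiv.Perm X} {x y : X} : (x, y) ∈ permRel σ ↔ x = σ y := by
  simp [permRel, eq_comm]

theorem mem_perm_mul_iff {σ : Equiv.Perm X} {R : SetRel X X} {x y : X} :
    (x, y) ∈ permRel σ * R ↔ (σ⁻¹ x, y) ∈ R := by
  rw [mem_mul_iff]
  constructor
  · rintro ⟨z, hz, h⟩
    rw [mem_perm_iff] at hz
    subst hz
    simpa using h
  · intro h
    exact ⟨σ⁻¹ x, mem_perm_iff.2 (by simp), h⟩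

theorem mem_mul_perm_iff {σ : Equiv.Perm X} {R : SetRel X X} {x y : X} :
    (x, y) ∈ R * permRel σ ↔ (x, σ y) ∈ R := by
  rw [mem_mul_iff]
  constructor
  · rintro ⟨z, h, hz⟩
    rw [mem_perm_iff] at hz
    subst hz
    exact h
  · intro h
    exact ⟨σ y, h, mem_perm_iff.2 rfl⟩

theorem mem_conj_iff {σ : Equiv.Perm X} {R : SetRel X X} {x y : X} :
    (x, y) ∈ conjRel σ R ↔ (σ⁻¹ x, σ⁻¹ y) ∈ R := by
  rw [conjRel, mem_mul_perm_iff, mem_perm_mul_iff]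

theorem perm_one : permRel (1 : Equiv.Perm X) = 1 := by
  ext ⟨x, y⟩
  rw [mem_perm_iff, mem_one_iff]
  rfl

theorem perm_mul (σ τ : Equiv.Perm X) : permRel (σ * τ) = permRel σ * permRel τ := by
  ext ⟨x, y⟩
  rw [mem_perm_mul_iff, mem_perm_iff, mem_perm_iff, Equiv.Perm.inv_eq_iff_eq]
  rfl

theorem Inessential.mul_left {R : SetRel X X} (h : Inessential R) (Q : SetRel X X) :
    Inessential (Q * R) := by
  obtain ⟨Y, hY, S, T, hc, rfl⟩ := h
  exact ⟨Y, hY, Q.comp S, T, hc, (SetRel.comp_assoc Q S T).symm⟩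

theorem Inessential.mul_right {R : SetRel X X} (h : Inessential R) (Q : SetRel X X) :
    Inessential (R * Q) := by
  obtain ⟨Y, hY, S, T, hc, rfl⟩ := h
  exact ⟨Y, hY, S, T.comp Q, hc, SetRel.comp_assoc S T Q⟩

theorem subset_transClosure (R : SetRel X X) : R ⊆ transClosure R :=
  fun _ h => Relation.TransGen.single h

theorem transClosure_trans {R : SetRel X X} {x y z : X} (h : (x, y) ∈ transClosure R)
    (h' : (y, z) ∈ transClosure R) : (x, z) ∈ transClosure R :=
  Relation.TransGen.trans h h'

theorem transClosure_min {R S : SetRel X X} (h : R ⊆ S)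
    (hS : ∀ x y z, (x, y) ∈ S → (y, z) ∈ S → (x, z) ∈ S) : transClosure R ⊆ S := by
  rintro ⟨x, y⟩ hxy
  change Relation.TransGen _ x y at hxy
  induction hxy with
  | single h1 => exact h h1
  | tail _ h1 ih => exact hS _ _ _ ih (h h1)

theorem transClosure_mono {R S : SetRel X X} (h : R ⊆ S) : transClosure R ⊆ transClosure S :=
  transClosure_min (h.trans (subset_transClosure S)) fun _ _ _ => transClosure_trans

theorem IsReflexive.transClosure {R : SetRel X X} (h : IsReflexive R) :
    IsReflexive (transClosure R) := fun x => subset_transClosure R (h x)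

theorem IsReflexive.mul {R S : SetRel X X} (hR : IsReflexive R) (hS : IsReflexive S) :
    IsReflexive (R * S) := fun x => ⟨x, hR x, hS x⟩

theorem IsReflexive.conjRel {R : SetRel X X} (h : IsReflexive R) (σ : Equiv.Perm X) :
    IsReflexive (conjRel σ R) := fun _ => mem_conj_iff.2 (h _)

theorem transClosure_mul_transClosure {R S : SetRel X X} (hR : IsReflexive R) (hS : IsReflexive S) :
    transClosure (R * transClosure S) = transClosure (R * S) := by
  apply subset_antisymm
  · refine transClosure_min ?_ fun _ _ _ => transClosure_trans
    rintro ⟨x, z⟩ ⟨y, hxy, hyz⟩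
    refine transClosure_trans (subset_transClosure _ (show (x, y) ∈ R * S from ⟨y, hxy, hS y⟩)) ?_
    exact transClosure_mono (fun p hp => (show (p.1, p.2) ∈ R * S from ⟨p.1, hR _, hp⟩)) hyz
  · refine transClosure_mono ?_
    rintro ⟨x, z⟩ ⟨y, hxy, hyz⟩
    exact ⟨y, hxy, subset_transClosure S hyz⟩

theorem transClosure_transClosure_mul {R S : SetRel X X} (hR : IsReflexive R) (hS : IsReflexive S) :
    transClosure (transClosure R * S) = transClosure (R * S) := by
  apply subset_antisymm
  · refine transClosure_min ?_ fun _ _ _ => transClosure_trans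
    rintro ⟨x, z⟩ ⟨y, hxy, hyz⟩
    refine transClosure_trans (y := y) ?_
      (subset_transClosure _ (show (y, z) ∈ R * S from ⟨y, hR y, hyz⟩))
    exact transClosure_mono (fun p hp => (show (p.1, p.2) ∈ R * S from ⟨p.2, hp, hS _⟩)) hxy
  · refine transClosure_mono ?_
    rintro ⟨x, z⟩ ⟨y, hxy, hyz⟩
    exact ⟨y, subset_transClosure R hxy, hyz⟩

theorem conj_transClosure_subset (σ : Equiv.Perm X) (R : SetRel X X) :
    transClosure (conjRel σ R) ⊆ conjRel σ (transClosure R) := by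
  refine transClosure_min ?_ ?_
  · rintro ⟨x, y⟩ h
    exact mem_conj_iff.2 (subset_transClosure R (mem_conj_iff.1 h))
  · intro x y z h h'
    exact mem_conj_iff.2 (transClosure_trans (mem_conj_iff.1 h) (mem_conj_iff.1 h'))

theorem conj_conj_inv (σ : Equiv.Perm X) (R : SetRel X X) : conjRel σ⁻¹ (conjRel σ R) = R := by
  ext ⟨x, y⟩
  simp [mem_conj_iff]

theorem conj_transClosure (σ : Equiv.Perm X) (R : SetRel X X) :
    conjRel σ (transClosure R) = transClosure (conjRel σ R) := by
  refine subset_antisymm ?_ (conj_transClosure_subset σ R)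
  rintro ⟨x, y⟩ h
  have h1 := conj_transClosure_subset σ⁻¹ (conjRel σ R)
  rw [conj_conj_inv] at h1
  simpa [mem_conj_iff] using h1 (mem_conj_iff.1 h)

theorem perm_mul_eq_conj_mul (σ : Equiv.Perm X) (R : SetRel X X) :
    permRel σ * R = conjRel σ R * permRel σ := by
  rw [conjRel, mul_assoc, ← perm_mul, inv_mul_cancel, perm_one, mul_one]

/-- If a reflexive relation is inessential, then so is its transitive closure. -/
theorem Inessential.transClosure [Finite X] {R : SetRel X X} (hR : IsReflexive R)
    (h : Inessential R) : Inessential (transClosure R) := by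
  classical
  by_cases hanti : ∀ x y, (x, y) ∈ PermutedOrders.transClosure R →
      (y, x) ∈ PermutedOrders.transClosure R → x = y
  · exfalso
    obtain ⟨Y, hY, S, T, hc, rfl⟩ := h
    choose f hf using hR
    refine absurd (Nat.card_le_card_of_injective f ?_) (not_le.2 hc)
    intro a b hab
    refine hanti a b (subset_transClosure _ ⟨f a, (hf a).1, ?_⟩)
      (subset_transClosure _ ⟨f b, (hf b).1, ?_⟩)
    · rw [hab]; exact (hf b).2
    · rw [← hab]; exact (hf a).2
  · push Not at hanti
    obtain ⟨a, b, hab, hba, hne⟩ := hanti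
    refine ⟨{x : X // x ≠ b}, inferInstance, {p | (p.1, p.2.1) ∈ PermutedOrders.transClosure R},
      {p | (p.1.1, p.2) ∈ PermutedOrders.transClosure R}, ?_, ?_⟩
    · exact Finite.card_subtype_lt (x := b) (by simp)
    · ext ⟨x, z⟩
      constructor
      · intro hxz
        by_cases hx : x = b
        · subst hx
          exact ⟨⟨a, hne⟩, hba, transClosure_trans hab hxz⟩
        · exact ⟨⟨x, hx⟩, hR.transClosure x, hxz⟩
      · rintro ⟨y, h1, h2⟩
        exact transClosure_trans h1 h2

/-- An essential relation contains a permutation. -/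
theorem inessential_or_perm_subset [Finite X] (R : SetRel X X) :
    Inessential R ∨ ∃ σ : Equiv.Perm X, permRel σ ⊆ R := by
  classical
  have := Fintype.ofFinite X
  by_cases hH : ∀ A : Finset X, A.card ≤ (A.biUnion fun a => {x | (x, a) ∈ R}).card
  · right
    obtain ⟨f, hf, hfR⟩ := (Finset.all_card_le_biUnion_card_iff_exists_injective _).1 hH
    refine ⟨Equiv.ofBijective f (Finite.injective_iff_bijective.1 hf), ?_⟩
    rintro _ ⟨x, rfl⟩
    simpa using hfR x
  · left
    push Not at hH
    obtain ⟨A, hA⟩ := hH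
    set B := A.biUnion fun a => ({x | (x, a) ∈ R} : Finset X) with hB
    refine ⟨{y // y ∈ Aᶜ} ⊕ {x // x ∈ B}, inferInstance,
      {p | Sum.elim (fun y => (p.1, y.1) ∈ R) (fun x => p.1 = x.1) p.2},
      {p | Sum.elim (fun y => y.1 = p.2) (fun x => (x.1, p.2) ∈ R) p.1}, ?_, ?_⟩
    · rw [Nat.card_sum, Nat.card_eq_fintype_card, Nat.card_eq_fintype_card,
        Nat.card_eq_fintype_card, Fintype.card_coe, Fintype.card_coe, Finset.card_compl]
      have := Finset.card_le_univ A
      omega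
    · ext ⟨x, z⟩
      constructor
      · intro h
        by_cases hz : z ∈ A
        · exact ⟨Sum.inr ⟨x, by simp only [hB, Finset.mem_biUnion]; exact ⟨z, hz, by simpa⟩⟩, rfl, h⟩
        · exact ⟨Sum.inl ⟨z, by simpa using hz⟩, h, rfl⟩
      · rintro ⟨y | y, h1, h2⟩
        · have h2' : y.1 = z := h2
          subst h2'
          exact h1
        · have h1' : x = y.1 := h1
          subst h1'
          exact h2

/-- An essential relation is the product of a permutation and a reflexive relation. -/
theorem inessential_or_eq_perm_mul [Finite X] (R : SetRel X X) :
    Inessential R ∨ ∃ (σ : Equiv.Perm X) (Q : SetRel X X), IsReflexive Q ∧ R = permRel σ * Q := by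
  refine (inessential_or_perm_subset R).imp_right ?_
  rintro ⟨σ, hσ⟩
  refine ⟨σ, permRel σ⁻¹ * R, fun x => mem_perm_mul_iff.2 ?_, ?_⟩
  · exact hσ (mem_perm_iff.2 (by simp))
  · rw [← mul_assoc, ← perm_mul, mul_inv_cancel, perm_one, one_mul]

end Relations

section Algebras

variable (k : Type v) [CommRing k] (X : Type u)

/-- The `k`-algebra of the monoid of all relations on `X`. -/
abbrev RelAlgebra : Type (max u v) := MonoidAlgebra k (SetRel X X)

theorem span_of_eq_top :
    Submodule.span k (Set.range (MonoidAlgebra.of k (SetRel X X))) = ⊤ := by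
  rw [eq_top_iff]
  rintro x -
  exact Submodule.span_mono (Set.image_subset_range _ _) (MonoidAlgebra.mem_span_support_coeff x)

variable {k X}

theorem mul_mem_span_left {A : Type*} [Ring A] [Algebra k A] {B G : Set A}
    (hB : Submodule.span k B = ⊤)
    (h : ∀ b ∈ B, ∀ g ∈ G, b * g ∈ Submodule.span k G) (a : A) {x : A}
    (hx : x ∈ Submodule.span k G) : a * x ∈ Submodule.span k G := by
  have ha : a ∈ Submodule.span k B := hB ▸ Submodule.mem_top
  have h1 := Submodule.mul_mem_mul ha hx
  rw [Submodule.span_mul_span] at h1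
  refine Submodule.span_le.2 ?_ h1
  rintro _ ⟨b, hb, g, hg, rfl⟩
  exact h b hb g hg

theorem mul_mem_span_right {A : Type*} [Ring A] [Algebra k A] {B G : Set A}
    (hB : Submodule.span k B = ⊤)
    (h : ∀ b ∈ B, ∀ g ∈ G, g * b ∈ Submodule.span k G) (a : A) {x : A}
    (hx : x ∈ Submodule.span k G) : x * a ∈ Submodule.span k G := by
  have ha : a ∈ Submodule.span k B := hB ▸ Submodule.mem_top
  have h1 := Submodule.mul_mem_mul hx ha
  rw [Submodule.span_mul_span] at h1
  refine Submodule.span_le.2 ?_ h1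
  rintro _ ⟨g, hg, b, hb, rfl⟩
  exact h b hb g hg

variable (k X)

/-- The two-sided ideal `I` of the algebra of relations: the `k`-span of all inessential
relations. -/
noncomputable def inessentialIdeal : Ideal (RelAlgebra k X) where
  __ := (Submodule.span k (MonoidAlgebra.of k (SetRel X X) '' {Q | Inessential Q})).toAddSubmonoid
  smul_mem' a x hx := by
    refine mul_mem_span_left (span_of_eq_top k X) ?_ a hx
    rintro _ ⟨T, rfl⟩ _ ⟨Q, hQ, rfl⟩
    rw [← map_mul]
    exact Submodule.subset_span ⟨_, Inessential.mul_left hQ T, rfl⟩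

instance inessentialIdeal_isTwoSided : (inessentialIdeal k X).IsTwoSided where
  mul_mem_of_left {x} a hx := by
    refine mul_mem_span_right (span_of_eq_top k X) ?_ a hx
    rintro _ ⟨T, rfl⟩ _ ⟨Q, hQ, rfl⟩
    rw [← map_mul]
    exact Submodule.subset_span ⟨_, Inessential.mul_right hQ T, rfl⟩

/-- The essential algebra. -/
abbrev EssentialAlgebra : Type (max u v) := RelAlgebra k X ⧸ inessentialIdeal k X

variable {X}

/-- The image of a relation in the essential algebra. -/
noncomputable def relE (Q : SetRel X X) : EssentialAlgebra k X :=
  Ideal.Quotient.mkₐ k (inessentialIdeal k X) (MonoidAlgebra.of k (SetRel X X) Q)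

theorem relE_mul (Q S : SetRel X X) : relE k (Q * S) = relE k Q * relE k S := by
  simp only [relE, map_mul]

theorem relE_eq_zero {Q : SetRel X X} (h : Inessential Q) : relE k Q = 0 :=
  Ideal.Quotient.eq_zero_iff_mem.2 (Submodule.subset_span ⟨Q, h, rfl⟩)

variable (X)

theorem span_relE_eq_top : Submodule.span k (Set.range (relE k (X := X))) = ⊤ := by
  have h := congrArg (Submodule.map (Ideal.Quotient.mkₐ k (inessentialIdeal k X)).toLinearMap)
    (span_of_eq_top k X)
  rw [Submodule.map_span, ← Set.range_comp, Submodule.map_top, LinearMap.range_eq_top.2] at h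
  · exact h
  · exact Ideal.Quotient.mkₐ_surjective k _

/-- The generators `(S - S̄) Δ_σ`, where `S` is a reflexive essential relation, `S̄` is its
transitive closure and `σ` is a permutation. -/
def nilGenerators : Set (EssentialAlgebra k X) :=
  {a | ∃ (S : SetRel X X) (σ : Equiv.Perm X), IsReflexive S ∧ Essential S ∧
    a = (relE k S - relE k (transClosure S)) * relE k (permRel σ)}

variable {X}

theorem sub_mul_mem [Finite X] {S : SetRel X X} (hS : IsReflexive S) (σ : Equiv.Perm X) :
    (relE k S - relE k (transClosure S)) * relE k (permRel σ) ∈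
      Submodule.span k (nilGenerators k X) := by
  by_cases h : Inessential S
  · rw [relE_eq_zero k h, relE_eq_zero k (h.transClosure hS)]
    simp
  · exact Submodule.subset_span ⟨S, σ, hS, h, rfl⟩

theorem sub_mul_mem' [Finite X] {S S' : SetRel X X} (hS : IsReflexive S) (hS' : IsReflexive S')
    (h : transClosure S = transClosure S') (σ : Equiv.Perm X) :
    (relE k S - relE k S') * relE k (permRel σ) ∈ Submodule.span k (nilGenerators k X) := by
  have := Submodule.sub_mem _ (sub_mul_mem k hS σ) (sub_mul_mem k hS' σ)
  rw [h, ← sub_mul] at this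
  simpa using this

variable (X)

/-- The two-sided ideal `N` of the essential algebra: the `k`-span of the elements
`(S - S̄) Δ_σ`. -/
noncomputable def nilIdeal [Finite X] : Ideal (EssentialAlgebra k X) where
  __ := (Submodule.span k (nilGenerators k X)).toAddSubmonoid
  smul_mem' a x hx := by
    refine mul_mem_span_left (span_relE_eq_top k X) ?_ a hx
    rintro _ ⟨T, rfl⟩ _ ⟨S, σ, hS, -, rfl⟩
    obtain hT | ⟨ρ, T, hT, rfl⟩ := inessential_or_eq_perm_mul T
    · rw [relE_eq_zero k hT, zero_mul]
      exact Submodule.zero_mem _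
    · have h := sub_mul_mem' k ((hT.mul hS).conjRel ρ) ((hT.mul hS.transClosure).conjRel ρ)
        (by rw [← conj_transClosure, ← conj_transClosure, transClosure_mul_transClosure hT hS])
        (ρ * σ)
      convert h using 1
      simp only [perm_mul, sub_mul, mul_sub, ← relE_mul, ← mul_assoc, ← perm_mul_eq_conj_mul]

instance nilIdeal_isTwoSided [Finite X] : (nilIdeal k X).IsTwoSided where
  mul_mem_of_left {x} a hx := by
    refine mul_mem_span_right (span_relE_eq_top k X) ?_ a hx
    rintro _ ⟨T, rfl⟩ _ ⟨S, σ, hS, -, rfl⟩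
    rw [mul_assoc, ← relE_mul]
    obtain hT | ⟨ρ, Q, hQ, h⟩ := inessential_or_eq_perm_mul (permRel σ * T)
    · rw [relE_eq_zero k hT, mul_zero]
      exact Submodule.zero_mem _
    · rw [h, perm_mul_eq_conj_mul]
      have h' := sub_mul_mem' k (hS.mul (hQ.conjRel ρ)) (hS.transClosure.mul (hQ.conjRel ρ))
        (transClosure_transClosure_mul hS (hQ.conjRel ρ)).symm ρ
      convert h' using 1
      simp only [sub_mul, ← relE_mul, mul_assoc]

/-- The algebra `𝒫` of permuted orders. -/
abbrev PermutedOrderAlgebra [Finite X] : Type (max u v) := EssentialAlgebra k X ⧸ nilIdeal k X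

/-- The composite of the two quotient maps, from the algebra of relations onto `𝒫`. It is through
this map that relations act on `𝒫`-modules. -/
noncomputable def toP [Finite X] : RelAlgebra k X →ₐ[k] PermutedOrderAlgebra k X :=
  (Ideal.Quotient.mkₐ k (nilIdeal k X)).comp (Ideal.Quotient.mkₐ k (inessentialIdeal k X))

variable {X}

/-- The image of a relation in `𝒫`. -/
noncomputable def relP [Finite X] (Q : SetRel X X) : PermutedOrderAlgebra k X :=
  toP k X (MonoidAlgebra.of k (SetRel X X) Q)

variable (X)

/-- The poset `𝒪` of all orders on `X`, with respect to containment. -/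
abbrev Orders : Type u := {R : SetRel X X // IsOrder R}

noncomputable instance [Finite X] : Fintype (Orders X) := Fintype.ofFinite _

open Classical in
noncomputable instance [Finite X] : LocallyFiniteOrder (Orders X) :=
  Fintype.toLocallyFiniteOrder

variable {X}

open Classical in
/-- The element `f_R = ∑ μ(R, S) S` of `𝒫`, the sum being over the orders `S` containing `R`, where
`μ` is the Möbius function of the poset of all orders on `X`. -/
noncomputable def orderIdem [Finite X] (R : Orders X) : PermutedOrderAlgebra k X :=
  ∑ S : Orders X with R ≤ S, IncidenceAlgebra.mu ℤ R S • relP k S.1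

/-- The left ideal `𝒫 f_R` of `𝒫`. -/
noncomputable def leftIdeal [Finite X] (R : Orders X) : Ideal (PermutedOrderAlgebra k X) :=
  Ideal.span {orderIdem k R}

end Algebras

end PermutedOrders

open PermutedOrders

/-! A relation is either inessential, hence zero in `𝒫`, or of the form `Δ_τ S` with `S` reflexive,
and `Δ_τ S Δ_σ = Δ_{τσ} S'` with `S'` the conjugate of `S` by `σ⁻¹`. The action on `Δ_σ f_R`
therefore reduces to reflexive `S` acting on `f_R`. In `𝒫` the product of `S` with an order `T` is
the closure of `ST`: their join if that is an order, zero otherwise. If `S ⊆ R`, every term of `f_R`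
absorbs `S`. If not, grouping the terms of `S f_R` by their join leaves sums of Möbius values that
vanish by Weisner's theorem (`sum_mu_join_eq_zero`).

Taking `σ = 1` shows that the `Δ_τ f_R` span `𝒫 f_R`. They are independent because the forms
`coeffForm` on `ℛ` vanish on the kernel of `ℛ → 𝒫` and are dual to lifts of these elements; this
rests on the fact that an order contains no permutation but the identity. -/

namespace PermutedOrders

/-! ### Reflexive relations, orders and permutations. -/

section Relations

variable {X : Type u}

/-- A reflexive relation contained in an order is essential. -/
theorem IsReflexive.essential_of_subset_isOrder [Finite X] {S R : SetRel X X}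
    (hS : IsReflexive S) (hR : IsOrder R) (h : S ⊆ R) : Essential S := by
  rintro ⟨Y, hY, A, B, hc, rfl⟩
  -- `f x` is an intermediate point through which `(x, x)` factors. If `f a = f b`, then `(a, b)`
  -- and `(b, a)` factor too, so antisymmetry makes `f` injective.
  choose f hf using hS
  refine absurd (Nat.card_le_card_of_injective f fun a b hab => ?_) (not_le.2 hc)
  refine hR.antisymm a b (h ⟨f a, (hf a).1, ?_⟩) (h ⟨f b, (hf b).1, ?_⟩)
  · rw [hab]; exact (hf b).2
  · rw [← hab]; exact (hf a).2

/-- The transitive closure of a reflexive relation is an order or inessential. -/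
theorem IsReflexive.isOrder_or_inessential [Finite X] {R : SetRel X X} (hR : IsReflexive R) :
    IsOrder (PermutedOrders.transClosure R) ∨ Inessential (PermutedOrders.transClosure R) := by
  classical
  have := Fintype.ofFinite X
  refine or_iff_not_imp_left.2 fun hO => ?_
  have hanti : ¬ ∀ x y, (x, y) ∈ PermutedOrders.transClosure R →
      (y, x) ∈ PermutedOrders.transClosure R → x = y :=
    fun h => hO ⟨hR.transClosure, h, fun _ _ _ => transClosure_trans⟩
  push Not at hanti
  obtain ⟨a, b, hab, hba, hne⟩ := hanti
  -- The points `a` and `b` are equivalent, so `b` can be dropped as a midpoint: `a` takes its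
  -- place.
  refine ⟨{x : X // x ≠ b}, inferInstance, {p | (p.1, p.2.1) ∈ PermutedOrders.transClosure R},
    {p | (p.1.1, p.2) ∈ PermutedOrders.transClosure R}, ?_, ?_⟩
  · exact Finite.card_subtype_lt (x := b) (by simp)
  · ext ⟨x, z⟩
    constructor
    · intro hxz
      by_cases hx : x = b
      · subst hx
        exact ⟨⟨a, hne⟩, hba, transClosure_trans hab hxz⟩
      · exact ⟨⟨x, hx⟩, hR.transClosure x, hxz⟩
    · rintro ⟨y, h1, h2⟩
      exact transClosure_trans h1 h2

theorem IsOrder.transClosure_eq {R : SetRel X X} (hR : IsOrder R) : transClosure R = R :=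
  (transClosure_min subset_rfl hR.trans).antisymm (subset_transClosure R)

/-- A permutation contained in an order on a finite set is the identity. -/
theorem IsOrder.eq_one_of_perm_subset [Finite X] {R : SetRel X X} (hR : IsOrder R)
    {σ : Equiv.Perm X} (h : permRel σ ⊆ R) : σ = 1 := by
  have hpow : ∀ (n : ℕ) (x : X), ((σ ^ n) x, x) ∈ R := by
    intro n
    induction n with
    | zero => exact fun x => hR.refl x
    | succ n ih =>
      intro x
      rw [pow_succ']
      exact hR.trans _ _ _ (h (mem_perm_iff.2 rfl)) (ih x)
  ext x
  refine hR.antisymm _ _ (h (mem_perm_iff.2 rfl)) ?_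
  -- This power of `σ` is `σ⁻¹`, so it sends `σ x` to `x` and yields the reversed pair `(x, σ x)`.
  have hx := hpow (orderOf σ - 1) (σ x)
  rwa [← Equiv.Perm.mul_apply, ← pow_succ, Nat.sub_add_cancel (orderOf_pos σ), pow_orderOf_eq_one]
    at hx

theorem transClosure_transClosure (R : SetRel X X) :
    transClosure (transClosure R) = transClosure R :=
  (transClosure_min subset_rfl fun _ _ _ => transClosure_trans).antisymm (subset_transClosure _)

theorem perm_one_subset_iff {R : SetRel X X} : permRel 1 ⊆ R ↔ IsReflexive R := by
  constructor
  · exact fun h x => h (mem_perm_iff.2 rfl)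
  · rintro h _ ⟨x, rfl⟩
    exact h x

/-- A reflexive relation contained in an order is absorbed by it. -/
theorem IsOrder.mul_eq_of_subset {S R : SetRel X X} (hR : IsOrder R) (hS : IsReflexive S)
    (h : S ⊆ R) : S * R = R := by
  ext ⟨x, z⟩
  constructor
  · rintro ⟨y, h1, h2⟩
    exact hR.trans _ _ _ (h h1) h2
  · exact fun hx => ⟨x, hS x, hx⟩

/-- Restores the normal form, permutation on the left, after multiplication by a permutation on the
right. -/
theorem perm_mul_mul_perm (τ σ : Equiv.Perm X) (S : SetRel X X) :
    permRel τ * S * permRel σ = permRel (τ * σ) * conjRel σ⁻¹ S := by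
  rw [conjRel, inv_inv, perm_mul]
  simp only [← mul_assoc]
  rw [mul_assoc (permRel τ) (permRel σ), ← perm_mul σ, mul_inv_cancel, perm_one, mul_one]

theorem conj_inv_subset_iff {σ : Equiv.Perm X} {S R : SetRel X X} :
    conjRel σ⁻¹ S ⊆ R ↔ S ⊆ conjRel σ R := by
  constructor
  · rintro h ⟨x, y⟩ hx
    exact mem_conj_iff.2 (h (mem_conj_iff.2 (by simpa using hx)))
  · rintro h ⟨x, y⟩ hx
    simpa [mem_conj_iff] using h (mem_conj_iff.1 hx)

theorem perm_mul_conj_inv (ρ : Equiv.Perm X) (S : SetRel X X) :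
    S * permRel ρ = permRel ρ * conjRel ρ⁻¹ S := by
  simpa [perm_one] using perm_mul_mul_perm 1 ρ S

/-! ### Joins and Weisner's theorem. -/

/-- With the next two lemmas: for reflexive `S` and `T`, the closure of `S * T` is the least order
containing both, as soon as some order does. -/
theorem subset_transClosure_mul_left {S T : SetRel X X} (hT : IsReflexive T) :
    S ⊆ transClosure (S * T) :=
  Set.Subset.trans (fun p hp => (⟨p.2, hp, hT _⟩ : (p.1, p.2) ∈ S * T)) (subset_transClosure _)

theorem subset_transClosure_mul_right {S T : SetRel X X} (hS : IsReflexive S) :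
    T ⊆ transClosure (S * T) :=
  Set.Subset.trans (fun p hp => (⟨p.1, hS _, hp⟩ : (p.1, p.2) ∈ S * T)) (subset_transClosure _)

theorem transClosure_mul_subset {S T U : SetRel X X} (hU : IsOrder U) (hS : S ⊆ U) (hT : T ⊆ U) :
    transClosure (S * T) ⊆ U := by
  refine transClosure_min ?_ hU.trans
  rintro ⟨x, z⟩ ⟨y, h1, h2⟩
  exact hU.trans _ _ _ (hS h1) (hT h2)

open Classical in
/-- Weisner's theorem in the poset of orders: the values `μ(R, T)` sum to zero over the orders `T`
whose join with a fixed reflexive relation `S` not contained in `R` is a given order `U`. -/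
theorem sum_mu_join_eq_zero [Finite X] {S : SetRel X X} (hS : IsReflexive S) {R : Orders X}
    (hSR : ¬ S ⊆ R.1) (U : Orders X) :
    ∑ T : Orders X with R ≤ T ∧ transClosure (S * T.1) = U.1, IncidenceAlgebra.mu ℤ R T = 0 := by
  induction U using WellFoundedLT.induction with
  | ind U ih =>
  by_cases hU : S ⊆ U.1
  swap
  · rw [Finset.filter_false_of_mem, Finset.sum_empty]
    rintro T - ⟨-, hT⟩
    exact hU (hT ▸ subset_transClosure_mul_left T.2.refl)
  -- Since `S ⊆ U` but not `S ⊆ R`, `U ≠ R` and the values `μ(R, T)` over the interval from `R` to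
  -- `U` sum to zero. Splitting this sum by the join of `T` with `S`, the fibres over smaller joins
  -- vanish by induction, so the fibre over `U` does too.
  have hIcc := IncidenceAlgebra.sum_Icc_mu_right (𝕜 := ℤ) R U
  rw [if_neg (by rintro rfl; exact hSR hU), ← Finset.sum_fiberwise_of_maps_to
    (g := fun T : Orders X => transClosure (S * T.1))
    -- When `R ≤ U`, `U` is already the value at `T = U`; the insertion covers the case of an empty
    -- interval.
    (t := insert U.1 ((Finset.Icc R U).image fun T : Orders X => transClosure (S * T.1)))
    (fun T hT => Finset.mem_insert_of_mem (Finset.mem_image_of_mem _ hT)),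
    Finset.sum_eq_single_of_mem U.1 (Finset.mem_insert_self _ _)] at hIcc
  · rw [← hIcc]
    refine Finset.sum_congr ?_ fun _ _ => rfl
    ext T
    simp only [Finset.mem_filter, Finset.mem_univ, true_and, Finset.mem_Icc]
    refine ⟨fun h => ⟨⟨h.1, ?_⟩, h.2⟩, fun h => ⟨h.1.1, h.2⟩⟩
    exact (subset_transClosure_mul_right hS).trans_eq h.2
  · intro V hV hVU
    obtain ⟨T, hT, rfl⟩ := Finset.mem_image.1 ((Finset.mem_insert.1 hV).resolve_left hVU)
    have hle := transClosure_mul_subset U.2 hU (Finset.mem_Icc.1 hT).2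
    -- Antisymmetry is inherited from `U`.
    have hO : IsOrder (transClosure (S * T.1)) :=
      ⟨(hS.mul T.2.refl).transClosure, fun x y h h' => U.2.antisymm x y (hle h) (hle h'),
        fun _ _ _ => transClosure_trans⟩
    rw [← ih ⟨_, hO⟩ (lt_of_le_of_ne hle fun h => hVU (congrArg Subtype.val h))]
    refine Finset.sum_congr ?_ fun _ _ => rfl
    ext T'
    simp only [Finset.mem_filter, Finset.mem_univ, true_and, Finset.mem_Icc]
    refine ⟨fun h => ⟨h.1.1, h.2⟩, fun h => ⟨⟨h.1, ?_⟩, h.2⟩⟩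
    exact ((subset_transClosure_mul_right hS).trans_eq h.2).trans hle

end Relations

/-! ### Coefficient forms and the image of relations in `𝒫`. -/

section Algebras

variable (k : Type v) [CommRing k] {X : Type u}

open Classical in
/-- The linear form on the algebra of relations which reads off the coefficient of `Δ_σ R`
in the algebra of permuted orders. -/
noncomputable def coeffForm (R : SetRel X X) (σ : Equiv.Perm X) : RelAlgebra k X →ₗ[k] k :=
  Finsupp.linearCombination k (fun Q : SetRel X X =>
    if IsReflexive (permRel σ⁻¹ * Q) ∧ transClosure (permRel σ⁻¹ * Q) = R then (1 : k) else 0) ∘ₗ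
    (MonoidAlgebra.coeffLinearEquiv k).toLinearMap

open Classical in
theorem coeffForm_of (R : SetRel X X) (σ : Equiv.Perm X) (Q : SetRel X X) :
    coeffForm k R σ (MonoidAlgebra.of k (SetRel X X) Q) =
      if IsReflexive (permRel σ⁻¹ * Q) ∧ transClosure (permRel σ⁻¹ * Q) = R then 1 else 0 := by
  change Finsupp.linearCombination k _ (Finsupp.single Q (1 : k)) = _
  rw [Finsupp.linearCombination_single, one_smul]

variable [Finite X]

theorem relP_mul (Q S : SetRel X X) : relP k (Q * S) = relP k Q * relP k S := by
  simp only [relP, map_mul]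

theorem relP_one : relP k (1 : SetRel X X) = 1 := by
  simp only [relP, map_one]

theorem relP_eq_zero {Q : SetRel X X} (h : Inessential Q) : relP k Q = 0 := by
  change Ideal.Quotient.mkₐ k (nilIdeal k X) (relE k Q) = 0
  rw [relE_eq_zero k h, map_zero]

theorem relP_transClosure {S : SetRel X X} (hS : IsReflexive S) :
    relP k (transClosure S) = relP k S := by
  refine (Ideal.Quotient.eq.2 ?_).symm
  have h := sub_mul_mem k hS 1
  rw [perm_one, show relE k (1 : SetRel X X) = 1 by simp only [relE, map_one], mul_one] at h
  exact h

theorem span_relP_eq_top : Submodule.span k (Set.range (relP k (X := X))) = ⊤ := by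
  have h := congrArg (Submodule.map (toP k X).toLinearMap) (span_of_eq_top k X)
  rw [Submodule.map_span, ← Set.range_comp, Submodule.map_top, LinearMap.range_eq_top.2] at h
  · exact h
  · exact (Ideal.Quotient.mkₐ_surjective k _).comp (Ideal.Quotient.mkₐ_surjective k _)

/-! ### The action of relations on `Δ_σ f_R`. -/

theorem relP_mul_orderIdem_of_subset {S : SetRel X X} (hS : IsReflexive S) {R : Orders X}
    (h : S ⊆ R.1) : relP k S * orderIdem k R = orderIdem k R := by
  classical
  rw [orderIdem, Finset.mul_sum]
  refine Finset.sum_congr rfl fun T hT => ?_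
  have hRT : R.1 ⊆ T.1 := (Finset.mem_filter.1 hT).2
  rw [mul_smul_comm, ← relP_mul, T.2.mul_eq_of_subset hS (h.trans hRT)]

theorem relP_mul_orderIdem_of_not_subset {S : SetRel X X} (hS : IsReflexive S) {R : Orders X}
    (h : ¬ S ⊆ R.1) : relP k S * orderIdem k R = 0 := by
  classical
  rw [orderIdem, Finset.mul_sum, ← Finset.sum_fiberwise_of_maps_to
    (g := fun T : Orders X => transClosure (S * T.1))
    (fun T hT => Finset.mem_image_of_mem (fun T : Orders X => transClosure (S * T.1)) hT)]
  refine Finset.sum_eq_zero fun V hV => ?_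
  have hterm : ∀ T ∈ (({T : Orders X | R ≤ T} : Finset (Orders X)).filter
      fun T => transClosure (S * T.1) = V),
      relP k S * IncidenceAlgebra.mu ℤ R T • relP k T.1 =
        IncidenceAlgebra.mu ℤ R T • relP k V := by
    intro T hT
    rw [mul_smul_comm, ← relP_mul, ← relP_transClosure k (hS.mul T.2.refl),
      (Finset.mem_filter.1 hT).2]
  rw [Finset.sum_congr rfl hterm, ← Finset.sum_smul, Finset.filter_filter]
  obtain ⟨T, -, rfl⟩ := Finset.mem_image.1 hV
  -- A join that is an order has coefficient zero by Weisner's theorem; a closure that is not an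
  -- order is itself zero in `𝒫`.
  obtain hO | hI := (hS.mul T.2.refl).isOrder_or_inessential
  · rw [sum_mu_join_eq_zero hS h ⟨_, hO⟩, zero_smul]
  · rw [relP_eq_zero k hI, smul_zero]

theorem relP_mul_perm_mul_orderIdem (R : Orders X) {Q : SetRel X X} {τ σ : Equiv.Perm X}
    (h1 : permRel 1 ⊆ permRel τ⁻¹ * Q) (h2 : permRel τ⁻¹ * Q ⊆ conjRel σ R.1) :
    relP k Q * (relP k (permRel σ) * orderIdem k R) =
      relP k (permRel (τ * σ)) * orderIdem k R := by
  have hQ : Q = permRel τ * (permRel τ⁻¹ * Q) := by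
    rw [← mul_assoc, ← perm_mul, mul_inv_cancel, perm_one, one_mul]
  rw [perm_one_subset_iff] at h1
  rw [← mul_assoc, ← relP_mul, hQ, perm_mul_mul_perm, relP_mul, mul_assoc,
    relP_mul_orderIdem_of_subset k (h1.conjRel _) (conj_inv_subset_iff.2 h2)]

theorem relP_mul_perm_mul_orderIdem_eq_zero (R : Orders X) {Q : SetRel X X} {σ : Equiv.Perm X}
    (h : ¬ ∃ τ : Equiv.Perm X, permRel 1 ⊆ permRel τ⁻¹ * Q ∧ permRel τ⁻¹ * Q ⊆ conjRel σ R.1) :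
    relP k Q * (relP k (permRel σ) * orderIdem k R) = 0 := by
  obtain hQ | ⟨τ, S, hS, rfl⟩ := inessential_or_eq_perm_mul Q
  · rw [relP_eq_zero k hQ, zero_mul]
  · have hSR : ¬ conjRel σ⁻¹ S ⊆ R.1 := by
      refine fun hSR => h ⟨τ, ?_⟩
      rw [← mul_assoc, ← perm_mul, inv_mul_cancel, perm_one, one_mul, ← perm_one]
      exact ⟨perm_one_subset_iff.2 hS, conj_inv_subset_iff.1 hSR⟩
    rw [← mul_assoc, ← relP_mul, perm_mul_mul_perm, relP_mul, mul_assoc,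
      relP_mul_orderIdem_of_not_subset k (hS.conjRel _) hSR, mul_zero]

/-! ### Linear independence. -/

-- If the coefficient is nonzero, the order `R` contains the permutation `σ⁻¹ * ρ`, which must then
-- be the identity.
open Classical in
theorem coeffForm_perm_mul {R : SetRel X X} (hR : IsOrder R) (σ ρ : Equiv.Perm X) {S : SetRel X X}
    (hS : IsReflexive S) :
    coeffForm k R σ (MonoidAlgebra.of k (SetRel X X) (permRel ρ * S)) =
      if ρ = σ ∧ transClosure S = R then 1 else 0 := by
  rw [coeffForm_of, ← mul_assoc, ← perm_mul]
  refine if_congr ⟨?_, ?_⟩ rfl rfl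
  · rintro ⟨-, h⟩
    have h1 : σ⁻¹ * ρ = 1 := by
      refine hR.eq_one_of_perm_subset (Set.Subset.trans ?_ (h ▸ subset_transClosure _))
      rintro ⟨x, y⟩ hxy
      exact ⟨y, hxy, hS y⟩
    rw [h1, perm_one, one_mul] at h
    exact ⟨(inv_mul_eq_one.1 h1).symm, h⟩
  · rintro ⟨rfl, h⟩
    rw [inv_mul_cancel, perm_one, one_mul]
    exact ⟨hS, h⟩

theorem coeffForm_eq_zero_of_mem_inessentialIdeal {R : SetRel X X} (hR : IsOrder R)
    (σ : Equiv.Perm X) {x : RelAlgebra k X} (hx : x ∈ inessentialIdeal k X) :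
    coeffForm k R σ x = 0 := by
  have hx' : x ∈ Submodule.span k
      (MonoidAlgebra.of k (SetRel X X) '' {Q | Inessential Q}) := hx
  refine (Submodule.span_le (p := LinearMap.ker (coeffForm k R σ))).2 ?_ hx'
  rintro _ ⟨Q, hQ, rfl⟩
  change coeffForm k R σ _ = 0
  rw [coeffForm_of, if_neg]
  rintro ⟨h1, h2⟩
  exact h1.essential_of_subset_isOrder hR (h2 ▸ subset_transClosure _) (Inessential.mul_left hQ _)

/-- Each element of `N` has a lift to `ℛ` killed by the form, and any two lifts differ by an element
of `I`, which the form kills as well. -/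
theorem coeffForm_eq_zero_of_toP_eq_zero {R : SetRel X X} (hR : IsOrder R) (σ : Equiv.Perm X)
    {x : RelAlgebra k X} (hx : toP k X x = 0) : coeffForm k R σ x = 0 := by
  have hlift : ∀ e ∈ Submodule.span k (nilGenerators k X), ∃ y : RelAlgebra k X,
      Ideal.Quotient.mkₐ k (inessentialIdeal k X) y = e ∧ coeffForm k R σ y = 0 := by
    intro e he
    induction he using Submodule.span_induction with
    | mem e he =>
      obtain ⟨S, ρ, hS, -, rfl⟩ := he
      refine ⟨MonoidAlgebra.of k (SetRel X X) (S * permRel ρ) -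
        MonoidAlgebra.of k (SetRel X X) (transClosure S * permRel ρ), ?_, ?_⟩
      · simp only [relE, map_sub, map_mul, sub_mul]
      -- Conjugation commutes with closure, so the two conjugates have the same closure and their
      -- coefficients cancel.
      · rw [map_sub, perm_mul_conj_inv, perm_mul_conj_inv,
          coeffForm_perm_mul k hR σ ρ (hS.conjRel _),
          coeffForm_perm_mul k hR σ ρ (hS.transClosure.conjRel _), ← conj_transClosure,
          ← conj_transClosure, transClosure_transClosure, sub_self]
    | zero => exact ⟨0, map_zero _, map_zero _⟩
    | add a b _ _ ha hb =>
      obtain ⟨y, rfl, hy⟩ := ha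
      obtain ⟨z, rfl, hz⟩ := hb
      exact ⟨y + z, map_add _ _ _, by rw [map_add, hy, hz, add_zero]⟩
    | smul c a _ ha =>
      obtain ⟨y, rfl, hy⟩ := ha
      exact ⟨c • y, map_smul _ _ _, by rw [map_smul, hy, smul_zero]⟩
  obtain ⟨y, hy, hy0⟩ := hlift (Ideal.Quotient.mkₐ k (inessentialIdeal k X) x)
    (Ideal.Quotient.eq_zero_iff_mem.1 hx)
  have h := coeffForm_eq_zero_of_mem_inessentialIdeal k hR σ (Ideal.Quotient.eq.1 hy)
  rwa [map_sub, hy0, zero_sub, neg_eq_zero] at h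

open Classical in
/-- A lift of `f_R` to the algebra of relations. -/
noncomputable def orderIdemLift (R : Orders X) : RelAlgebra k X :=
  ∑ S : Orders X with R ≤ S, IncidenceAlgebra.mu ℤ R S • MonoidAlgebra.of k (SetRel X X) S.1

theorem toP_orderIdemLift (R : Orders X) : toP k X (orderIdemLift k R) = orderIdem k R := by
  simp only [orderIdemLift, orderIdem, map_sum, map_zsmul, relP]

-- Each order is its own closure, so only the term `S = R` of the lift contributes, with `μ(R, R) =
-- 1`.
open Classical in
theorem coeffForm_perm_mul_orderIdemLift (R : Orders X) (σ ρ : Equiv.Perm X) :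
    coeffForm k R.1 σ (MonoidAlgebra.of k (SetRel X X) (permRel ρ) * orderIdemLift k R) =
      if ρ = σ then 1 else 0 := by
  rw [orderIdemLift, Finset.mul_sum, map_sum, Finset.sum_eq_single_of_mem R (by simp)]
  · rw [IncidenceAlgebra.mu_self, one_smul, ← map_mul, coeffForm_perm_mul k R.2 σ ρ R.2.refl]
    simp [R.2.transClosure_eq]
  · intro S _ hSR
    rw [mul_smul_comm, map_zsmul, ← map_mul, coeffForm_perm_mul k R.2 σ ρ S.2.refl, if_neg,
      smul_zero]
    rintro ⟨-, h⟩
    exact hSR (Subtype.ext (S.2.transClosure_eq ▸ h))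

theorem linearIndependent_perm_mul_orderIdem (R : Orders X) :
    LinearIndependent k fun σ : Equiv.Perm X => relP k (permRel σ) * orderIdem k R := by
  classical
  have := Fintype.ofFinite (Equiv.Perm X)
  rw [Fintype.linearIndependent_iff]
  intro c hc σ
  have h : toP k X (∑ ρ, c ρ •
      (MonoidAlgebra.of k (SetRel X X) (permRel ρ) * orderIdemLift k R)) = 0 := by
    rw [← hc]
    simp only [map_sum, map_smul, map_mul, toP_orderIdemLift, relP]
  have h' := coeffForm_eq_zero_of_toP_eq_zero k R.2 σ h
  simpa only [map_sum, map_smul, coeffForm_perm_mul_orderIdemLift, smul_eq_mul, mul_ite, mul_one,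
    mul_zero, Finset.sum_ite_eq', Finset.mem_univ, if_true] using h'

/-! ### Spanning and the basis. -/

theorem mul_orderIdem_mem_span (R : Orders X) (a : PermutedOrderAlgebra k X) :
    a * orderIdem k R ∈
      Submodule.span k (Set.range fun σ => relP k (permRel σ) * orderIdem k R) := by
  have ha : a ∈ Submodule.span k (Set.range (relP k (X := X))) :=
    span_relP_eq_top k (X := X) ▸ Submodule.mem_top
  induction ha using Submodule.span_induction with
  | mem a ha =>
    obtain ⟨Q, rfl⟩ := ha
    have h1 : relP k Q * orderIdem k R = relP k Q * (relP k (permRel 1) * orderIdem k R) := by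
      rw [perm_one, relP_one, one_mul]
    rw [h1]
    by_cases h : ∃ τ : Equiv.Perm X,
        permRel 1 ⊆ permRel τ⁻¹ * Q ∧ permRel τ⁻¹ * Q ⊆ conjRel 1 R.1
    · obtain ⟨τ, h2, h3⟩ := h
      rw [relP_mul_perm_mul_orderIdem k R h2 h3]
      exact Submodule.subset_span ⟨τ * 1, rfl⟩
    · rw [relP_mul_perm_mul_orderIdem_eq_zero k R h]
      exact Submodule.zero_mem _
  | zero => rw [zero_mul]; exact Submodule.zero_mem _
  | add a b _ _ ha hb => rw [add_mul]; exact Submodule.add_mem _ ha hb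
  | smul c a _ ha => rw [smul_mul_assoc]; exact Submodule.smul_mem _ c ha

/-- The elements `Δ_σ f_R` as elements of the left ideal `𝒫 f_R`. -/
noncomputable def leftIdealVec (R : Orders X) (σ : Equiv.Perm X) : leftIdeal k R :=
  ⟨relP k (permRel σ) * orderIdem k R, Ideal.mul_mem_left _ _ (Ideal.mem_span_singleton_self _)⟩

/-- The elements `Δ_σ f_R` form a basis of the left ideal `𝒫 f_R`. -/
noncomputable def leftIdealBasis (R : Orders X) :
    Module.Basis (Equiv.Perm X) k (leftIdeal k R) :=
  Module.Basis.mk (v := leftIdealVec k R)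
    (LinearIndependent.of_comp ((leftIdeal k R).subtype.restrictScalars k)
      (linearIndependent_perm_mul_orderIdem k R)) <| by
    rintro ⟨x, hx⟩ -
    obtain ⟨a, rfl⟩ := Ideal.mem_span_singleton'.1 hx
    have h := mul_orderIdem_mem_span k R a
    -- Spanning is known inside `𝒫`; it is carried back to the left ideal along the injective
    -- inclusion.
    have hrange : (Set.range fun σ => relP k (permRel σ) * orderIdem k R) =
        ((leftIdeal k R).subtype.restrictScalars k) '' Set.range (leftIdealVec k R) := by
      rw [← Set.range_comp]
      rfl
    rw [hrange, Submodule.span_image] at h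
    obtain ⟨y, hy, hyx⟩ := h
    rwa [show (⟨a * orderIdem k R, hx⟩ : leftIdeal k R) = y from Subtype.ext hyx.symm]

theorem coe_leftIdealBasis (R : Orders X) (σ : Equiv.Perm X) :
    (leftIdealBasis k R σ : PermutedOrderAlgebra k X) =
      relP k (permRel σ) * orderIdem k R := by
  rw [leftIdealBasis, Module.Basis.mk_apply]
  rfl

end Algebras

end PermutedOrders

theorem proposition8p5 {k : Type*} [CommRing k] {X : Type*} [Finite X]
    (R : SetRel X X) (hR : IsOrder R) :
    ∃ b : Module.Basis (Equiv.Perm X) k (leftIdeal k ⟨R, hR⟩),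
      (∀ σ : Equiv.Perm X,
        (b σ : PermutedOrderAlgebra k X) = relP k (permRel σ) * orderIdem k ⟨R, hR⟩) ∧
      ∀ (Q : SetRel X X) (σ : Equiv.Perm X),
        (∀ τ : Equiv.Perm X,
          permRel 1 ⊆ permRel τ⁻¹ * Q → permRel τ⁻¹ * Q ⊆ conjRel σ R →
            relP k Q • b σ = b (τ * σ)) ∧
        ((¬ ∃ τ : Equiv.Perm X, permRel 1 ⊆ permRel τ⁻¹ * Q ∧ permRel τ⁻¹ * Q ⊆ conjRel σ R) →
          relP k Q • b σ = 0) := by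
  refine ⟨leftIdealBasis k ⟨R, hR⟩, coe_leftIdealBasis k ⟨R, hR⟩, fun Q σ => ⟨?_, ?_⟩⟩
  · intro τ h1 h2
    refine Subtype.ext ?_
    rw [Submodule.coe_smul, smul_eq_mul, coe_leftIdealBasis, coe_leftIdealBasis]
    exact relP_mul_perm_mul_orderIdem k ⟨R, hR⟩ h1 h2
  · intro h
    refine Subtype.ext ?_
    rw [Submodule.coe_smul, smul_eq_mul, coe_leftIdealBasis]
    exact relP_mul_perm_mul_orderIdem_eq_zero k ⟨R, hR⟩ h
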